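/- All manifolds are smooth, real, finite-dimensional, Hausdorff and without boundary. A \emph{Jacobi structure} on a manifold $M$ is a pair $(\pi_M,E_M)$ of a smooth bivector field and a smooth vector field with $[\pi_M,\pi_M]=2E_M\wedge\pi_M$ and $[E_M,\pi_M]=0$ (Schouten brackets). If $\dim M=2n+1$, $n\ge 0$, the \emph{singular locus} of $(\pi_M,E_M)$ is the set of points where $E_M\wedge\pi_M^{\,n}$ vanishes; the structure is \emph{contact} on a set $U\subseteq M$ if $U$ does not meet the singular locus, and $M$ is a \emph{contact manifold} if it is contact on all of $M$. A \emph{contact resolution} of $(M,\pi_M,E_M)$ consists of a contact manifold $(\Sigma,\pi_\Sigma,E_\Sigma)$ with $\dim\Sigma=\dim M$ and a surjective Jacobi morphism $\varphi:\Sigma\to M$, that is, a smooth surjective map with $\wedge^2T_\sigma\varphi(\pi_\Sigma)=\pi_M(\varphi(\sigma))$ and $T_\sigma\varphi(E_\Sigma)=E_M(\varphi(\sigma))$ for all $\sigma\in\Sigma$. It is \emph{proper} if $\varphi$ is a proper map. \textbf{Theorem.} Let $(M,\pi_M,E_M)$ be a Jacobi manifold of dimension $2n+1$ which is contact on a dense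 open subset of $M$, and suppose that its singular locus contains a nonempty (embedded or injectively immersed) submanifold of codimension $1$. Then $(M,\pi_M,E_M)$ admits no proper contact resolution. -/

import Mathlib

open scoped Manifold ContDiff

noncomputable section

namespace JacobiGeometry

section Pointwise

variable {d : ℕ} {M : Type*} [TopologicalSpace M] [ChartedSpace (EuclideanSpace ℝ (Fin d)) M]

/-- The differential `df` at `x` of a real function on a `d`-dimensional manifold, as a
covector at `x`. -/
def differential (f : M → ℝ) (x : M) : Module.Dual ℝ (TangentSpace (𝓡 d) x) :=
  (mvfderiv (𝓡 d) f x : TangentSpace (𝓡 d) x →ₗ[ℝ] ℝ)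

/-- The function `π(df, dg)`, for a field of bivectors `π`. The pairing is normalized so that
`(X ∧ Y)(df, dg) = X f * Y g - Y f * X g`. -/
def bivPair (π : ∀ x : M, ⋀[ℝ]^2 (TangentSpace (𝓡 d) x)) (f g : M → ℝ) : M → ℝ := fun x =>
  exteriorPower.pairingDual ℝ (TangentSpace (𝓡 d) x) 2
    (exteriorPower.ιMulti ℝ 2 ![differential f x, differential g x]) (π x)

/-- The function `E f = df(E)`, for a vector field `E`. -/
def lieD (E : ∀ x : M, TangentSpace (𝓡 d) x) (f : M → ℝ) : M → ℝ := fun x =>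
  differential f x (E x)

/-- The function `[π, π](df, dg, dh)`, where `[π, π]` is the Schouten bracket of `π` with
itself. With `{f, g} = π(df, dg)` it equals
`2 * ({f, {g, h}} + {g, {h, f}} + {h, {f, g}})`. -/
def schoutenSelf (π : ∀ x : M, ⋀[ℝ]^2 (TangentSpace (𝓡 d) x)) (f g h : M → ℝ) : M → ℝ :=
  fun x => 2 * (bivPair π f (bivPair π g h) x + bivPair π g (bivPair π h f) x
    + bivPair π h (bivPair π f g) x)

/-- The function `(E ∧ π)(df, dg, dh)`. -/
def wedgeTriple (E : ∀ x : M, TangentSpace (𝓡 d) x)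
    (π : ∀ x : M, ⋀[ℝ]^2 (TangentSpace (𝓡 d) x)) (f g h : M → ℝ) : M → ℝ :=
  fun x => lieD E f x * bivPair π g h x + lieD E g x * bivPair π h f x
    + lieD E h x * bivPair π f g x

/-- The function `[E, π](df, dg)`, where `[E, π]` is the Lie derivative of `π` along `E`. -/
def lieBiv (E : ∀ x : M, TangentSpace (𝓡 d) x)
    (π : ∀ x : M, ⋀[ℝ]^2 (TangentSpace (𝓡 d) x)) (f g : M → ℝ) : M → ℝ :=
  fun x => lieD E (bivPair π f g) x - bivPair π (lieD E f) g x - bivPair π f (lieD E g) x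

end Pointwise

/-- A (smooth) Jacobi structure on a `d`-dimensional manifold `M`: a smooth bivector field `π`
and a smooth vector field `E` with `[π, π] = 2 E ∧ π` and `[E, π] = 0`. Smoothness of `π` and the
two tensor identities are tested on (triples of) globally defined smooth functions; on a Hausdorff
manifold the differentials of these span every cotangent space, and coordinate functions
extend to global smooth functions after shrinking the chart. -/
structure JacobiStructure (d : ℕ) (M : Type*) [TopologicalSpace M]
    [ChartedSpace (EuclideanSpace ℝ (Fin d)) M] [IsManifold (𝓡 d) ∞ M] where
  /-- the bivector field -/
  π : ∀ x : M, ⋀[ℝ]^2 (TangentSpace (𝓡 d) x)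
  /-- the vector field -/
  E : ∀ x : M, TangentSpace (𝓡 d) x
  smooth_π : ∀ f g : M → ℝ, ContMDiff (𝓡 d) 𝓘(ℝ, ℝ) ∞ f → ContMDiff (𝓡 d) 𝓘(ℝ, ℝ) ∞ g →
    ContMDiff (𝓡 d) 𝓘(ℝ, ℝ) ∞ (bivPair π f g)
  smooth_E : ContMDiff (𝓡 d) (𝓡 d).tangent ∞ (fun x => (⟨x, E x⟩ : TangentBundle (𝓡 d) M))
  schouten_π_π : ∀ f g h : M → ℝ, ContMDiff (𝓡 d) 𝓘(ℝ, ℝ) ∞ f →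
    ContMDiff (𝓡 d) 𝓘(ℝ, ℝ) ∞ g → ContMDiff (𝓡 d) 𝓘(ℝ, ℝ) ∞ h →
    ∀ x, schoutenSelf π f g h x = 2 * wedgeTriple E π f g h x
  schouten_E_π : ∀ f g : M → ℝ, ContMDiff (𝓡 d) 𝓘(ℝ, ℝ) ∞ f →
    ContMDiff (𝓡 d) 𝓘(ℝ, ℝ) ∞ g → ∀ x, lieBiv E π f g x = 0

namespace JacobiStructure

variable {n : ℕ} {M : Type*} [TopologicalSpace M]
  [ChartedSpace (EuclideanSpace ℝ (Fin (2 * n + 1))) M] [IsManifold (𝓡 (2 * n + 1)) ∞ M]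

/-- The top multivector `E ∧ π ∧ ⋯ ∧ π` (with `n` factors `π`) at `x`, as an element of the
exterior algebra of the tangent space. -/
def topWedge (J : JacobiStructure (2 * n + 1) M) (x : M) :
    ExteriorAlgebra ℝ (TangentSpace (𝓡 (2 * n + 1)) x) :=
  ExteriorAlgebra.ι ℝ (J.E x) *
    (J.π x : ExteriorAlgebra ℝ (TangentSpace (𝓡 (2 * n + 1)) x)) ^ n

/-- The singular locus: the points where `E ∧ π ^ n` vanishes. -/
def singularLocus (J : JacobiStructure (2 * n + 1) M) : Set M := {x | J.topWedge x = 0}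

/-- The Jacobi structure is contact: `E ∧ π ^ n` vanishes nowhere. -/
def IsContact (J : JacobiStructure (2 * n + 1) M) : Prop := ∀ x, J.topWedge x ≠ 0

/-- The Jacobi structure is contact on a dense open set. -/
def IsContactOnDenseOpen (J : JacobiStructure (2 * n + 1) M) : Prop :=
  ∃ U : Set M, IsOpen U ∧ Dense U ∧ ∀ x ∈ U, J.topWedge x ≠ 0

end JacobiStructure

/-- `φ : S → M` is a Jacobi morphism from `(S, K)` to `(M, J)`: it is smooth and it pushes the
bivector field and the vector field of `K` forward to those of `J`. -/
structure IsJacobiMorphism {d e : ℕ} {S M : Type*}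
    [TopologicalSpace S] [ChartedSpace (EuclideanSpace ℝ (Fin d)) S] [IsManifold (𝓡 d) ∞ S]
    [TopologicalSpace M] [ChartedSpace (EuclideanSpace ℝ (Fin e)) M] [IsManifold (𝓡 e) ∞ M]
    (K : JacobiStructure d S) (J : JacobiStructure e M) (φ : S → M) : Prop where
  smooth : ContMDiff (𝓡 d) (𝓡 e) ∞ φ
  map_π : ∀ s, exteriorPower.map 2
    ((mfderiv (𝓡 d) (𝓡 e) φ s :
      TangentSpace (𝓡 d) s →L[ℝ] TangentSpace (𝓡 e) (φ s)) :
      TangentSpace (𝓡 d) s →ₗ[ℝ] TangentSpace (𝓡 e) (φ s)) (K.π s) = J.π (φ s)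
  map_E : ∀ s, mfderiv (𝓡 d) (𝓡 e) φ s (K.E s) = J.E (φ s)

/-- `(S, K, φ)` is a contact resolution of `(M, J)`: `(S, K)` is a contact manifold of the same
dimension as `M`, and `φ` is a surjective Jacobi morphism. -/
structure IsContactResolution {n : ℕ} {S M : Type*}
    [TopologicalSpace S] [ChartedSpace (EuclideanSpace ℝ (Fin (2 * n + 1))) S]
    [IsManifold (𝓡 (2 * n + 1)) ∞ S]
    [TopologicalSpace M] [ChartedSpace (EuclideanSpace ℝ (Fin (2 * n + 1))) M]
    [IsManifold (𝓡 (2 * n + 1)) ∞ M]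
    (K : JacobiStructure (2 * n + 1) S) (J : JacobiStructure (2 * n + 1) M)
    (φ : S → M) : Prop where
  contact : K.IsContact
  morphism : IsJacobiMorphism K J φ
  surjective : Function.Surjective φ

end JacobiGeometry

end

/-! In charts, `E ∧ π ^ n` becomes a scalar `topCoeff`. A Jacobi morphism between manifolds of equal
dimension pushes one top multivector to the other, so the Jacobian determinant times the coefficient
upstairs equals the coefficient downstairs (`IsJacobiMorphism.det_fderiv_mul_topCoeff`). Upstairs
the coefficient is nonzero. Downstairs it vanishes on a hypersurface, hence is `O(|u|)` for a
coordinate `u` cutting out the hypersurface (`JacobiStructure.exists_abs_topCoeff_le`). Properness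
makes the preimage of a small closed ball compact, so finitely many chart pieces of finite volume
cover it, on each of which the Jacobian is at most a constant times `|u|` of the image point.

This contradicts surjectivity: covering the part of the ball where `|u|` is about `2 ^ (-k)`, whose
volume is of order `2 ^ (-k)`, requires source volume bounded below independently of `k`. These
disjoint preimages would have infinite total volume (`not_ball_subset_biUnion_image_of_det_le`). -/

/-! ### The volume estimate -/

open MeasureTheory Set in
/-- A set containing a neighbourhood of `y₀` cannot be covered by finitely many differentiable
images of sets of finite volume if the Jacobian determinants are dominated by a linear coordinate
`u` that vanishes at `y₀`: the function `1 / |u|` is not integrable near `y₀`. -/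
theorem not_ball_subset_biUnion_image_of_det_le {E ι : Type*} [NormedAddCommGroup E]
    [NormedSpace ℝ E] [FiniteDimensional ℝ E] [MeasurableSpace E] [BorelSpace E]
    (μ : Measure E) [μ.IsAddHaarMeasure] (t : Finset ι) (V : ι → Set E)
    (hV : ∀ i, IsOpen (V i)) (hfin : ∀ i, μ (V i) ≠ ⊤) (Φ : ι → E → E) (Φ' : ι → E → E →L[ℝ] E)
    (hΦ : ∀ i, ∀ x ∈ V i, HasFDerivAt (Φ i) (Φ' i x) x) (u : E →L[ℝ] ℝ) (v : E) (huv : u v = 1)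
    (y₀ : E) {r : ℝ} (hr : 0 < r) (C : ℝ)
    (hdet : ∀ i ∈ t, ∀ x ∈ V i, Φ i x ∈ Metric.ball y₀ r →
      |(Φ' i x).det| ≤ C * |u (Φ i x - y₀)|) :
    ¬ Metric.ball y₀ r ⊆ ⋃ i ∈ t, Φ i '' V i := by
  intro hcov
  obtain ⟨ρ, hρ, hρr⟩ : ∃ ρ : ℝ, 0 < ρ ∧ ρ + ρ * ‖v‖ < r := by
    refine ⟨r / (2 + ‖v‖), by positivity, ?_⟩
    have : 0 < 2 + ‖v‖ := by positivity
    rw [← mul_one_add, div_mul_eq_mul_div, div_lt_iff₀ this]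
    nlinarith
  set p : ℕ → ℝ := fun k => (1 / 2) ^ k with hp
  have hp0 : ∀ k, 0 < p k := fun k => by positivity
  have hp1 : ∀ k, p k ≤ 1 := fun k => pow_le_one₀ (by norm_num) (by norm_num)
  -- Disjoint dyadic slabs approaching the hyperplane `u = u y₀`; the last condition bounds the
  -- component along `ker u`.
  set A : ℕ → Set E := fun k => {y | p k * ρ / 2 < |u (y - y₀)| ∧ |u (y - y₀)| < p k * ρ ∧
    ‖(y - y₀) - u (y - y₀) • v‖ < ρ} with hA
  have hAo : ∀ k, IsOpen (A k) := by
    intro k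
    have h1 : Continuous fun y => |u (y - y₀)| := by fun_prop
    have h2 : Continuous fun y => ‖(y - y₀) - u (y - y₀) • v‖ := by fun_prop
    exact (isOpen_lt continuous_const h1).inter
      ((isOpen_lt h1 continuous_const).inter (isOpen_lt h2 continuous_const))
  have hAball : ∀ k, A k ⊆ Metric.ball y₀ r := by
    rintro k y ⟨-, h2, h3⟩
    rw [Metric.mem_ball, dist_eq_norm]
    have hle : |u (y - y₀)| ≤ ρ := h2.le.trans (by nlinarith [hp1 k])
    calc ‖y - y₀‖ = ‖((y - y₀) - u (y - y₀) • v) + u (y - y₀) • v‖ := by rw [sub_add_cancel]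
      _ ≤ ‖(y - y₀) - u (y - y₀) • v‖ + ‖u (y - y₀) • v‖ := norm_add_le _ _
      _ ≤ ρ + ρ * ‖v‖ := by
        rw [norm_smul, Real.norm_eq_abs]
        gcongr
      _ < r := hρr
  have hAdisj : Pairwise (Function.onFun Disjoint A) := by
    have key : ∀ j k, j < k → Disjoint (A j) (A k) := by
      intro j k hjk
      rw [Set.disjoint_left]
      rintro y ⟨h1, -, -⟩ ⟨-, h2, -⟩
      have : p k ≤ p j / 2 := by
        have h : p k ≤ p (j + 1) := pow_le_pow_of_le_one (by norm_num) (by norm_num) hjk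
        have e : p (j + 1) = p j / 2 := by simp only [hp]; ring
        rwa [e] at h
      nlinarith
    intro j k hjk
    rcases lt_or_gt_of_ne hjk with h | h
    · exact key j k h
    · exact (key k j h).symm
  -- Contracting by `p k` along `v` and fixing `ker u` sends `A 0` into `A k`, with determinant `p
  -- k`.
  have hμA : ∀ k, ENNReal.ofReal (p k) * μ (A 0) ≤ μ (A k) := by
    intro k
    have hT : (LinearMap.transvection ((p k - 1) • (u : E →ₗ[ℝ] ℝ)) v).det = p k := by
      rw [LinearMap.transvection.det]
      simp [huv]
    have hsub : (fun y => y₀ + y) '' (LinearMap.transvection ((p k - 1) • (u : E →ₗ[ℝ] ℝ)) v ''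
        ((fun y => y₀ + y) ⁻¹' A 0)) ⊆ A k := by
      rintro _ ⟨_, ⟨w, ⟨h1, h2, h3⟩, rfl⟩, rfl⟩
      simp only [add_sub_cancel_left] at h1 h2 h3
      have hp00 : p 0 = 1 := by simp [hp]
      rw [hp00] at h1 h2
      have e1 : u (w + ((p k - 1) * u w) • v) = p k * u w := by
        simp [huv]; ring
      simp only [hA, mem_ofPred_eq, add_sub_cancel_left, LinearMap.transvection.apply,
        LinearMap.smul_apply, ContinuousLinearMap.coe_coe, smul_eq_mul, e1, abs_mul,
        abs_of_pos (hp0 k)]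
      have h4 := hp0 k
      refine ⟨by nlinarith, by nlinarith, ?_⟩
      convert h3 using 2
      module
    calc ENNReal.ofReal (p k) * μ (A 0)
        = μ ((fun y => y₀ + y) '' (LinearMap.transvection ((p k - 1) • (u : E →ₗ[ℝ] ℝ)) v ''
        ((fun y => y₀ + y) ⁻¹' A 0))) := by
          rw [image_add_left, measure_preimage_add, Measure.addHaar_image_linearMap, hT,
            measure_preimage_add, abs_of_pos (hp0 k)]
      _ ≤ μ (A k) := measure_mono hsub
  have hA0 : μ (A 0) ≠ 0 := by
    refine ((hAo 0).measure_pos μ ⟨y₀ + (3 / 4 * ρ) • v, ?_⟩).ne'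
    have : |3 / 4 * ρ| = 3 / 4 * ρ := abs_of_pos (by positivity)
    simp only [hA, hp, mem_ofPred_eq, add_sub_cancel_left, map_smul, huv, smul_eq_mul, mul_one,
      sub_self, norm_zero, pow_zero, one_mul, this]
    exact ⟨by linarith, by linarith, hρ⟩
  set W : ι → ℕ → Set E := fun i k => V i ∩ Φ i ⁻¹' A k with hW
  have hWo : ∀ i k, IsOpen (W i k) := fun i k =>
    ContinuousOn.isOpen_inter_preimage
      (fun x hx => (hΦ i x hx).continuousAt.continuousWithinAt) (hV i) (hAo k)
  -- The volume of the slab and the bound on the Jacobian both scale like `p k`, which cancels.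
  have hle : ∀ k, μ (A 0) ≤ ENNReal.ofReal (C * ρ) * ∑ i ∈ t, μ (W i k) := by
    intro k
    have h1 : μ (A k) ≤ ∑ i ∈ t, ENNReal.ofReal (C * ρ * p k) * μ (W i k) := by
      calc μ (A k) ≤ μ (⋃ i ∈ t, Φ i '' W i k) := by
            refine measure_mono fun y hy => ?_
            obtain ⟨i, hi, x, hx, rfl⟩ := mem_iUnion₂.1 (hcov (hAball k hy))
            exact mem_iUnion₂.2 ⟨i, hi, x, ⟨hx, hy⟩, rfl⟩
        _ ≤ ∑ i ∈ t, μ (Φ i '' W i k) := measure_biUnion_finset_le _ _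
        _ ≤ _ := by
            refine Finset.sum_le_sum fun i hi => ?_
            calc μ (Φ i '' W i k)
                ≤ ∫⁻ x in W i k, ENNReal.ofReal |(Φ' i x).det| ∂μ :=
                  addHaar_image_le_lintegral_abs_det_fderiv μ (hWo i k).measurableSet
                    fun x hx => (hΦ i x hx.1).hasFDerivWithinAt
              _ ≤ ∫⁻ _ in W i k, ENNReal.ofReal (C * ρ * p k) ∂μ := by
                  refine setLIntegral_mono' (hWo i k).measurableSet fun x hx => ?_
                  refine ENNReal.ofReal_le_ofReal ?_
                  have h2 := hdet i hi x hx.1 (hAball k hx.2)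
                  have h3 : p k * ρ / 2 < |u (Φ i x - y₀)| := hx.2.1
                  have h4 : |u (Φ i x - y₀)| < p k * ρ := hx.2.2.1
                  have h5 : 0 < |u (Φ i x - y₀)| := by
                    have := mul_pos (hp0 k) hρ
                    linarith
                  have hC : 0 ≤ C := by
                    by_contra hneg
                    have := abs_nonneg (Φ' i x).det
                    nlinarith
                  nlinarith
              _ = _ := by rw [setLIntegral_const]
    have h2 := (hμA k).trans h1
    rw [← Finset.mul_sum, mul_comm (C * ρ), ENNReal.ofReal_mul (hp0 k).le, mul_assoc] at h2
    exact (ENNReal.mul_le_mul_iff_right (by simpa using hp0 k) ENNReal.ofReal_ne_top).1 h2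
  have hsum : ∑' _ : ℕ, μ (A 0) ≤ ENNReal.ofReal (C * ρ) * ∑ i ∈ t, μ (V i) := by
    calc ∑' _ : ℕ, μ (A 0) ≤ ∑' k, ENNReal.ofReal (C * ρ) * ∑ i ∈ t, μ (W i k) :=
          ENNReal.tsum_le_tsum hle
      _ = ENNReal.ofReal (C * ρ) * ∑ i ∈ t, ∑' k, μ (W i k) := by
          rw [ENNReal.tsum_mul_left, Summable.tsum_finsetSum fun _ _ => ENNReal.summable]
      _ ≤ _ := by
          gcongr with i hi
          rw [← measure_iUnion (fun j k hjk => ((hAdisj hjk).preimage (Φ i)).mono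
            inter_subset_right inter_subset_right) fun k => (hWo i k).measurableSet]
          exact measure_mono (iUnion_subset fun k => inter_subset_left)
  rw [ENNReal.tsum_const_eq_top_of_ne_zero hA0, top_le_iff] at hsum
  exact ENNReal.mul_ne_top ENNReal.ofReal_ne_top (ENNReal.sum_ne_top.2 fun i _ => hfin i) hsum

/-! ### Determinants on the exterior algebra -/

section Multilinear

variable {V W : Type*} [AddCommGroup V] [Module ℝ V] [AddCommGroup W] [Module ℝ W] {d : ℕ}

/-- The linear form on the exterior algebra that extends the determinant with respect to the
basis `b` and vanishes in all degrees other than the top one. -/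
noncomputable def ExteriorAlgebra.topForm (b : Module.Basis (Fin d) ℝ V) :
    ExteriorAlgebra ℝ V →ₗ[ℝ] ℝ :=
  ExteriorAlgebra.liftAlternating (Pi.single (M := fun i => V [⋀^Fin i]→ₗ[ℝ] ℝ) d b.det)

theorem ExteriorAlgebra.topForm_ιMulti (b : Module.Basis (Fin d) ℝ V) (m : Fin d → V) :
    topForm b (ιMulti ℝ d m) = b.det m := by
  rw [topForm, liftAlternating_apply_ιMulti, Pi.single_eq_same]

theorem ExteriorAlgebra.topForm_map (b : Module.Basis (Fin d) ℝ V) (L : V →ₗ[ℝ] V)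
    (z : ExteriorAlgebra ℝ V) : topForm b (map L z) = L.det * topForm b z := by
  suffices h : topForm b ∘ₗ (map L).toLinearMap = L.det • topForm b from LinearMap.congr_fun h z
  refine lhom_ext fun i => ?_
  ext m
  rcases eq_or_ne i d with rfl | hi
  · simp [topForm_ιMulti, Module.Basis.det_comp]
  · simp [topForm, liftAlternating_apply_ιMulti, Pi.single_eq_of_ne hi]

/-- The top exterior power is a line, and the form takes the value 1 on the wedge of the basis. -/
theorem ExteriorAlgebra.topForm_ne_zero (b : Module.Basis (Fin d) ℝ V) {z : ExteriorAlgebra ℝ V}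
    (hz : z ∈ ⋀[ℝ]^d V) (h0 : z ≠ 0) : topForm b z ≠ 0 := by
  have : Module.Finite ℝ V := .of_basis b
  have hrank : Module.finrank ℝ (⋀[ℝ]^d V) = 1 := by
    rw [exteriorPower.finrank_eq, Module.finrank_eq_card_basis b, Fintype.card_fin,
      Nat.choose_self]
  have hne : (⟨z, hz⟩ : ⋀[ℝ]^d V) ≠ 0 := fun h => h0 (congrArg Subtype.val h)
  obtain ⟨c, hc⟩ := (finrank_eq_one_iff_of_nonzero' _ hne).1 hrank
    (exteriorPower.ιMulti ℝ d b)
  intro h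
  have h1 : topForm b (ιMulti ℝ d b) = c • topForm b z := by
    rw [← map_smul, ← exteriorPower.ιMulti_apply_coe, ← hc]
    rfl
  rw [topForm_ιMulti, h, smul_zero, Module.Basis.det_self] at h1
  exact one_ne_zero h1

/-- The coordinate expression of the image of a bivector under a linear map. -/
theorem exteriorPower.coe_map_two_eq_sum (b : Module.Basis (Fin d) ℝ W) (L : V →ₗ[ℝ] W)
    (z : ⋀[ℝ]^2 V) :
    (exteriorPower.map 2 L z : ExteriorAlgebra ℝ W) =
      ∑ i, ∑ j, ((1 / 2 : ℝ) * pairingDual ℝ V 2 (ιMulti ℝ 2 ![b.coord i ∘ₗ L, b.coord j ∘ₗ L]) z) •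
        (ExteriorAlgebra.ι ℝ (b i) * ExteriorAlgebra.ι ℝ (b j)) := by
  suffices h : (⋀[ℝ]^2 W).subtype ∘ₗ exteriorPower.map 2 L = ∑ i, ∑ j, ((1 / 2 : ℝ) •
      (pairingDual ℝ V 2 (ιMulti ℝ 2 ![b.coord i ∘ₗ L, b.coord j ∘ₗ L]))).smulRight
        (ExteriorAlgebra.ι ℝ (b i) * ExteriorAlgebra.ι ℝ (b j)) by
    simpa [LinearMap.sum_apply] using LinearMap.congr_fun h z
  ext m
  have hL : ∀ v, ExteriorAlgebra.ι ℝ (L v) =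
      ∑ i, b.coord i (L v) • ExteriorAlgebra.ι ℝ (b i) := by
    intro v
    conv_lhs => rw [← b.sum_repr (L v)]
    simp only [map_sum, map_smul, Module.Basis.coord_apply]
  have hprod : ∀ v w, ExteriorAlgebra.ι ℝ (L v) * ExteriorAlgebra.ι ℝ (L w) =
      ∑ i, ∑ j, (b.coord i (L v) * b.coord j (L w)) •
        (ExteriorAlgebra.ι ℝ (b i) * ExteriorAlgebra.ι ℝ (b j)) := by
    intro v w
    rw [hL v, hL w, Finset.sum_mul_sum]
    simp only [smul_mul_smul_comm]
  have hanti : ExteriorAlgebra.ι ℝ (L (m 1)) * ExteriorAlgebra.ι ℝ (L (m 0)) =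
      -(ExteriorAlgebra.ι ℝ (L (m 0)) * ExteriorAlgebra.ι ℝ (L (m 1))) :=
    eq_neg_of_add_eq_zero_right (ExteriorAlgebra.ι_add_mul_swap _ _)
  -- Antisymmetrizing produces the 2×2 determinants of the pairing; the factor `1 / 2` compensates
  -- for summing over ordered pairs.
  have key : ExteriorAlgebra.ι ℝ (L (m 0)) * ExteriorAlgebra.ι ℝ (L (m 1)) =
      (1 / 2 : ℝ) • (ExteriorAlgebra.ι ℝ (L (m 0)) * ExteriorAlgebra.ι ℝ (L (m 1)) -
        ExteriorAlgebra.ι ℝ (L (m 1)) * ExteriorAlgebra.ι ℝ (L (m 0))) := by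
    rw [hanti]
    module
  have hlhs : ((⋀[ℝ]^2 W).subtype ∘ₗ exteriorPower.map 2 L).compAlternatingMap
      (ιMulti ℝ 2) m = ExteriorAlgebra.ι ℝ (L (m 0)) * ExteriorAlgebra.ι ℝ (L (m 1)) := by
    simp [ExteriorAlgebra.ιMulti_apply]
    rfl
  rw [hlhs, key, hprod, hprod, ← Finset.sum_sub_distrib, Finset.smul_sum]
  simp only [LinearMap.compAlternatingMap_apply, LinearMap.sum_apply, LinearMap.smulRight_apply,
    LinearMap.smul_apply, pairingDual_ιMulti_ιMulti, Matrix.det_fin_two, Matrix.of_apply,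
    ← Finset.sum_sub_distrib, Finset.smul_sum, ← sub_smul, smul_smul]
  refine Finset.sum_congr rfl fun i _ => Finset.sum_congr rfl fun j _ => ?_
  congr 1
  simp
  ring

theorem ExteriorAlgebra.map_coe_exteriorPower (L : V →ₗ[ℝ] W) {k : ℕ} (z : ⋀[ℝ]^k V) :
    ExteriorAlgebra.map L (z : ExteriorAlgebra ℝ V) = exteriorPower.map k L z := by
  suffices h : (ExteriorAlgebra.map L).toLinearMap ∘ₗ (⋀[ℝ]^k V).subtype =
      (⋀[ℝ]^k W).subtype ∘ₗ exteriorPower.map k L from LinearMap.congr_fun h z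
  ext m
  simp

end Multilinear

/-! ### Charts and coordinate functions -/

section Charts

open Filter Topology

variable {d : ℕ} {M : Type*} [TopologicalSpace M] [ChartedSpace (EuclideanSpace ℝ (Fin d)) M]

/-- The differential of a chart, with values in the model space. -/
noncomputable def chartDeriv (ψ : OpenPartialHomeomorph M (EuclideanSpace ℝ (Fin d))) (x : M) :
    TangentSpace (𝓡 d) x →ₗ[ℝ] EuclideanSpace ℝ (Fin d) :=
  (mvfderiv (𝓡 d) ψ x : TangentSpace (𝓡 d) x →ₗ[ℝ] EuclideanSpace ℝ (Fin d))

/-- The standard basis of Euclidean space. -/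
noncomputable abbrev euclideanBasis (d : ℕ) :
    Module.Basis (Fin d) ℝ (EuclideanSpace ℝ (Fin d)) :=
  (EuclideanSpace.basisFun (Fin d) ℝ).toBasis

theorem mem_maximalAtlas_one {ψ : OpenPartialHomeomorph M (EuclideanSpace ℝ (Fin d))}
    (hψ : ψ ∈ IsManifold.maximalAtlas (𝓡 d) ∞ M) : ψ ∈ IsManifold.maximalAtlas (𝓡 d) 1 M :=
  IsManifold.maximalAtlas_subset_of_le (by simp) hψ

theorem exists_leftInverse_chartDeriv {ψ : OpenPartialHomeomorph M (EuclideanSpace ℝ (Fin d))}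
    (hψ : ψ ∈ IsManifold.maximalAtlas (𝓡 d) ∞ M) {x : M} (hx : x ∈ ψ.source) :
    ∃ L : EuclideanSpace ℝ (Fin d) →ₗ[ℝ] TangentSpace (𝓡 d) x,
      L ∘ₗ chartDeriv ψ x = LinearMap.id := by
  have h1 := mem_maximalAtlas_one hψ
  have hD : ψ.MDifferentiable (𝓡 d) (𝓡 d) :=
    ⟨fun y hy => (mdifferentiableAt_of_mem_maximalAtlas h1 hy).mdifferentiableWithinAt,
      fun y hy => (mdifferentiableAt_symm_of_mem_maximalAtlas h1 hy).mdifferentiableWithinAt⟩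
  exact LinearMap.exists_leftInverse_of_injective _
    (LinearMap.ker_eq_bot.2 (hD.mfderiv_injective hx))

theorem differential_eq_of_eventuallyEq_chart
    {ψ : OpenPartialHomeomorph M (EuclideanSpace ℝ (Fin d))}
    (hψ : ψ ∈ IsManifold.maximalAtlas (𝓡 d) ∞ M) {x : M} (hx : x ∈ ψ.source) {f : M → ℝ}
    {i : Fin d} (hf : f =ᶠ[𝓝 x] fun y => ψ y i) :
    JacobiGeometry.differential f x = (euclideanBasis d).coord i ∘ₗ chartDeriv ψ x := by
  have h1 : MDifferentiableAt (𝓡 d) (𝓡 d) ψ x :=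
    mdifferentiableAt_of_mem_maximalAtlas (mem_maximalAtlas_one hψ) hx
  have h2 : HasMFDerivAt (𝓡 d) 𝓘(ℝ, ℝ) (EuclideanSpace.proj (𝕜 := ℝ) i) (ψ x)
      (EuclideanSpace.proj (𝕜 := ℝ) i : EuclideanSpace ℝ (Fin d) →L[ℝ] ℝ) :=
    (EuclideanSpace.proj (𝕜 := ℝ) i).hasFDerivAt.hasMFDerivAt
  have h3 : HasMFDerivAt (𝓡 d) 𝓘(ℝ, ℝ) f x _ :=
    (h2.comp x h1.hasMFDerivAt).congr_of_eventuallyEq hf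
  ext v
  change mfderiv (𝓡 d) 𝓘(ℝ, ℝ) f x v = (euclideanBasis d).repr (chartDeriv ψ x v) i
  rw [h3.mfderiv]
  rfl

variable [IsManifold (𝓡 d) ∞ M]

/-- Near any point of its domain, the coordinates of a chart extend to global smooth functions. -/
theorem exists_contMDiff_eventuallyEq_chart [T2Space M]
    {ψ : OpenPartialHomeomorph M (EuclideanSpace ℝ (Fin d))}
    (hψ : ψ ∈ IsManifold.maximalAtlas (𝓡 d) ∞ M) {x₀ : M} (hx₀ : x₀ ∈ ψ.source) :
    ∃ f : Fin d → M → ℝ, (∀ i, ContMDiff (𝓡 d) 𝓘(ℝ, ℝ) ∞ (f i)) ∧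
      ∀ᶠ x in 𝓝 x₀, ∀ i, f i =ᶠ[𝓝 x] fun y => ψ y i := by
  obtain ⟨η, -, hη⟩ := (SmoothBumpFunction.nhds_basis_tsupport (I := 𝓡 d) x₀).mem_iff.1
    (ψ.open_source.mem_nhds hx₀)
  refine ⟨fun i y => η y • ψ y i, fun i => ?_, ?_⟩
  · refine contMDiff_of_tsupport fun x hx => ?_
    have hxs : x ∈ ψ.source := hη (tsupport_smul_subset_left _ _ hx)
    refine η.contMDiffAt.smul ?_
    exact ((EuclideanSpace.proj (𝕜 := ℝ) i).contDiff.contMDiff.contMDiffAt (x := ψ x)).comp x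
      (contMDiffAt_of_mem_maximalAtlas hψ hxs)
  · filter_upwards [η.eventuallyEq_one.eventuallyEq_nhds] with x hx i
    filter_upwards [hx] with y hy
    simp [hy]

theorem contMDiff_lieD {E : ∀ x : M, TangentSpace (𝓡 d) x}
    (hE : ContMDiff (𝓡 d) (𝓡 d).tangent ∞ (fun x => (⟨x, E x⟩ : TangentBundle (𝓡 d) M)))
    {f : M → ℝ} (hf : ContMDiff (𝓡 d) 𝓘(ℝ, ℝ) ∞ f) :
    ContMDiff (𝓡 d) 𝓘(ℝ, ℝ) ∞ (JacobiGeometry.lieD E f) :=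
  (contMDiff_snd_tangentBundle_modelSpace ℝ 𝓘(ℝ, ℝ)).comp
    ((hf.contMDiff_tangentMap (m := ∞) (by simp)).comp hE)

end Charts

/-! ### The top multivector in a chart -/

namespace JacobiGeometry.JacobiStructure

open Filter Topology

variable {n : ℕ} {M : Type*} [TopologicalSpace M]
  [ChartedSpace (EuclideanSpace ℝ (Fin (2 * n + 1))) M] [IsManifold (𝓡 (2 * n + 1)) ∞ M]

/-- The coefficient of the top multivector `E ∧ π ^ n` in the chart `ψ`. -/
noncomputable def topCoeff (J : JacobiStructure (2 * n + 1) M)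
    (ψ : OpenPartialHomeomorph M (EuclideanSpace ℝ (Fin (2 * n + 1)))) (x : M) : ℝ :=
  ExteriorAlgebra.topForm (euclideanBasis (2 * n + 1))
    (ExteriorAlgebra.map (chartDeriv ψ x) (J.topWedge x))

theorem topWedge_mem (J : JacobiStructure (2 * n + 1) M) (x : M) :
    J.topWedge x ∈ ⋀[ℝ]^(2 * n + 1) (TangentSpace (𝓡 (2 * n + 1)) x) := by
  have h := Submodule.mul_mem_mul
    (LinearMap.mem_range_self (ExteriorAlgebra.ι ℝ) (J.E x)) (Submodule.pow_mem_pow _ (J.π x).2 n)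
  rwa [← pow_mul, ← pow_succ'] at h

/-- A left inverse of the chart's differential makes the induced map of exterior algebras injective,
and the top form is injective in top degree. -/
theorem topCoeff_ne_zero (J : JacobiStructure (2 * n + 1) M)
    {ψ : OpenPartialHomeomorph M (EuclideanSpace ℝ (Fin (2 * n + 1)))}
    (hψ : ψ ∈ IsManifold.maximalAtlas (𝓡 (2 * n + 1)) ∞ M) {x : M} (hx : x ∈ ψ.source)
    (h : J.topWedge x ≠ 0) : J.topCoeff ψ x ≠ 0 := by
  obtain ⟨L, hL⟩ := exists_leftInverse_chartDeriv hψ hx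
  refine ExteriorAlgebra.topForm_ne_zero _ ?_ fun h0 => h ?_
  · have := ExteriorAlgebra.map_coe_exteriorPower (chartDeriv ψ x) ⟨_, J.topWedge_mem x⟩
    rw [this]
    exact Subtype.coe_prop _
  · have h1 := congrArg (ExteriorAlgebra.map L) h0
    rwa [← AlgHom.comp_apply, ExteriorAlgebra.map_comp_map, hL, ExteriorAlgebra.map_id,
      AlgHom.id_apply, map_zero] at h1

/-- Locally the components of `E` and `π` are their values on coordinate functions. Replacing these
by global extensions makes the smoothness axioms applicable. -/
theorem contMDiffAt_topCoeff [T2Space M] (J : JacobiStructure (2 * n + 1) M)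
    {ψ : OpenPartialHomeomorph M (EuclideanSpace ℝ (Fin (2 * n + 1)))}
    (hψ : ψ ∈ IsManifold.maximalAtlas (𝓡 (2 * n + 1)) ∞ M) {x₀ : M} (hx₀ : x₀ ∈ ψ.source) :
    ContMDiffAt (𝓡 (2 * n + 1)) 𝓘(ℝ, ℝ) ∞ (J.topCoeff ψ) x₀ := by
  obtain ⟨f, hf, hfψ⟩ := exists_contMDiff_eventuallyEq_chart hψ hx₀
  set e := fun i => ExteriorAlgebra.ι ℝ (euclideanBasis (2 * n + 1) i) with he
  set P : M → ExteriorAlgebra ℝ (EuclideanSpace ℝ (Fin (2 * n + 1))) := fun x =>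
    ∑ i, ∑ j, ((1 / 2 : ℝ) * bivPair J.π (f i) (f j) x) • (e i * e j) with hP
  set X : M → ExteriorAlgebra ℝ (EuclideanSpace ℝ (Fin (2 * n + 1))) := fun x =>
    ∑ i, lieD J.E (f i) x • e i with hX
  -- Quantifying over all linear forms `l` lets the induction absorb right multiplication by `e i *
  -- e j` into `l`.
  have hsmooth : ∀ (k : ℕ) (l : ExteriorAlgebra ℝ (EuclideanSpace ℝ (Fin (2 * n + 1))) →ₗ[ℝ] ℝ),
      ContMDiff (𝓡 (2 * n + 1)) 𝓘(ℝ, ℝ) ∞ fun x => l (X x * P x ^ k) := by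
    intro k
    induction k with
    | zero =>
      intro l
      simp only [hX, pow_zero, mul_one, map_sum, map_smul, smul_eq_mul]
      exact ContMDiff.sum fun i _ => (contMDiff_lieD J.smooth_E (hf i)).mul contMDiff_const
    | succ k ih =>
      intro l
      have h : (fun x => l (X x * P x ^ (k + 1))) = fun x => ∑ i, ∑ j,
          ((1 / 2 : ℝ) * bivPair J.π (f i) (f j) x) *
            (l ∘ₗ LinearMap.mulRight ℝ (e i * e j)) (X x * P x ^ k) := by
        funext x
        rw [pow_succ, ← mul_assoc]
        conv_lhs => enter [2, 2]; simp only [hP]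
        simp only [Finset.mul_sum, map_sum, mul_smul_comm, map_smul, smul_eq_mul,
          LinearMap.comp_apply, LinearMap.mulRight_apply]
      rw [h]
      exact ContMDiff.sum fun i _ => ContMDiff.sum fun j _ =>
        (contMDiff_const.mul (J.smooth_π _ _ (hf i) (hf j))).mul (ih _)
  refine (hsmooth n (ExteriorAlgebra.topForm (euclideanBasis _))).contMDiffAt.congr_of_eventuallyEq
    ?_
  filter_upwards [hfψ, ψ.open_source.mem_nhds hx₀] with x hx hxs
  have hd := fun i => differential_eq_of_eventuallyEq_chart hψ hxs (hx i)
  have h1 : ExteriorAlgebra.map (chartDeriv ψ x) (J.π x : ExteriorAlgebra ℝ _) = P x := by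
    rw [ExteriorAlgebra.map_coe_exteriorPower,
      exteriorPower.coe_map_two_eq_sum (euclideanBasis (2 * n + 1))]
    simp only [hP, bivPair, hd, he]
  have h2 : ExteriorAlgebra.map (chartDeriv ψ x) (ExteriorAlgebra.ι ℝ (J.E x)) = X x := by
    rw [ExteriorAlgebra.map_apply_ι, ← (euclideanBasis (2 * n + 1)).sum_repr (chartDeriv ψ x _)]
    simp only [hX, lieD, hd, he, map_sum, map_smul, LinearMap.comp_apply,
      Module.Basis.coord_apply]
  rw [topCoeff, topWedge, map_mul, map_pow, h1, h2]

end JacobiGeometry.JacobiStructure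

/-! ### Jacobi morphisms and hypersurfaces in the singular locus -/

namespace JacobiGeometry

open Filter Topology

variable {n : ℕ} {M : Type*} [TopologicalSpace M]
  [ChartedSpace (EuclideanSpace ℝ (Fin (2 * n + 1))) M] [IsManifold (𝓡 (2 * n + 1)) ∞ M]

theorem IsJacobiMorphism.map_topWedge {S : Type*} [TopologicalSpace S]
    [ChartedSpace (EuclideanSpace ℝ (Fin (2 * n + 1))) S] [IsManifold (𝓡 (2 * n + 1)) ∞ S]
    {K : JacobiStructure (2 * n + 1) S} {J : JacobiStructure (2 * n + 1) M} {φ : S → M}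
    (hφ : IsJacobiMorphism K J φ) (s : S) :
    ExteriorAlgebra.map ((mfderiv (𝓡 (2 * n + 1)) (𝓡 (2 * n + 1)) φ s :
      TangentSpace (𝓡 (2 * n + 1)) s →L[ℝ] TangentSpace (𝓡 (2 * n + 1)) (φ s)) :
      TangentSpace (𝓡 (2 * n + 1)) s →ₗ[ℝ] TangentSpace (𝓡 (2 * n + 1)) (φ s))
      (K.topWedge s) = J.topWedge (φ s) := by
  rw [JacobiStructure.topWedge, map_mul, map_pow, ExteriorAlgebra.map_apply_ι,
    ExteriorAlgebra.map_coe_exteriorPower, hφ.map_π, JacobiStructure.topWedge, ← hφ.map_E]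
  rfl

/-- The top coefficients of two Jacobi structures that are related by a Jacobi morphism differ by
the Jacobian determinant. -/
theorem IsJacobiMorphism.det_fderiv_mul_topCoeff {S : Type*} [TopologicalSpace S]
    [ChartedSpace (EuclideanSpace ℝ (Fin (2 * n + 1))) S] [IsManifold (𝓡 (2 * n + 1)) ∞ S]
    {K : JacobiStructure (2 * n + 1) S} {J : JacobiStructure (2 * n + 1) M} {φ : S → M}
    (hφ : IsJacobiMorphism K J φ)
    {χ : OpenPartialHomeomorph S (EuclideanSpace ℝ (Fin (2 * n + 1)))}
    (hχ : χ ∈ IsManifold.maximalAtlas (𝓡 (2 * n + 1)) ∞ S)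
    {ψ : OpenPartialHomeomorph M (EuclideanSpace ℝ (Fin (2 * n + 1)))}
    (hψ : ψ ∈ IsManifold.maximalAtlas (𝓡 (2 * n + 1)) ∞ M) {s : S} (hs : s ∈ χ.source)
    (hφs : φ s ∈ ψ.source) :
    DifferentiableAt ℝ (ψ ∘ φ ∘ χ.symm) (χ s) ∧
      (fderiv ℝ (ψ ∘ φ ∘ χ.symm) (χ s)).det * K.topCoeff χ s = J.topCoeff ψ (φ s) := by
  have hφd : MDifferentiableAt (𝓡 (2 * n + 1)) (𝓡 (2 * n + 1)) φ s :=
    hφ.smooth.mdifferentiableAt (by simp)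
  have hψd := mdifferentiableAt_of_mem_maximalAtlas (mem_maximalAtlas_one hψ) hφs
  have hχd := mdifferentiableAt_of_mem_maximalAtlas (mem_maximalAtlas_one hχ) hs
  have hχs := mdifferentiableAt_symm_of_mem_maximalAtlas (mem_maximalAtlas_one hχ)
    (χ.map_source hs)
  have hΦ : MDifferentiableAt (𝓡 (2 * n + 1)) (𝓡 (2 * n + 1)) (ψ ∘ φ ∘ χ.symm) (χ s) := by
    refine MDifferentiableAt.comp (I' := 𝓡 (2 * n + 1)) _ ?_
      (MDifferentiableAt.comp (I' := 𝓡 (2 * n + 1)) _ ?_ hχs)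
    · simpa [χ.left_inv hs] using hψd
    · simpa [χ.left_inv hs] using hφd
  have hΦd : DifferentiableAt ℝ (ψ ∘ φ ∘ χ.symm) (χ s) := mdifferentiableAt_iff_differentiableAt.1 hΦ
  refine ⟨hΦd, ?_⟩
  have h1 := (hψd.hasMFDerivAt.comp s hφd.hasMFDerivAt)
  have h2 := (hΦd.hasFDerivAt.hasMFDerivAt.comp s hχd.hasMFDerivAt)
  have heq : ψ ∘ φ =ᶠ[𝓝 s] (ψ ∘ φ ∘ χ.symm) ∘ χ := by
    filter_upwards [χ.open_source.mem_nhds hs] with y hy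
    simp [χ.left_inv hy]
  have h3 := hasMFDerivAt_unique h1 (h2.congr_of_eventuallyEq heq)
  have hlin : chartDeriv ψ (φ s) ∘ₗ ((mfderiv (𝓡 (2 * n + 1)) (𝓡 (2 * n + 1)) φ s :
      TangentSpace (𝓡 (2 * n + 1)) s →L[ℝ] TangentSpace (𝓡 (2 * n + 1)) (φ s)) :
      TangentSpace (𝓡 (2 * n + 1)) s →ₗ[ℝ] TangentSpace (𝓡 (2 * n + 1)) (φ s)) =
      (fderiv ℝ (ψ ∘ φ ∘ χ.symm) (χ s) : EuclideanSpace ℝ (Fin (2 * n + 1)) →ₗ[ℝ]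
        EuclideanSpace ℝ (Fin (2 * n + 1))) ∘ₗ chartDeriv χ s :=
    LinearMap.ext fun v => DFunLike.congr_fun h3 v
  rw [JacobiStructure.topCoeff, JacobiStructure.topCoeff, ← hφ.map_topWedge, ← AlgHom.comp_apply,
    ExteriorAlgebra.map_comp_map, hlin, ← ExteriorAlgebra.map_comp_map, AlgHom.comp_apply,
    ExteriorAlgebra.topForm_map]

/-- Near a point of a hypersurface contained in the singular locus, the top coefficient is
dominated by a linear coordinate in a suitable chart. -/
theorem JacobiStructure.exists_abs_topCoeff_le [T2Space M] (J : JacobiStructure (2 * n + 1) M)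
    {N : Type*} [TopologicalSpace N]
    [ChartedSpace (EuclideanSpace ℝ (Fin (2 * n))) N]
    {i : N → M} (hi : Manifold.IsImmersion (𝓡 (2 * n)) (𝓡 (2 * n + 1)) ∞ i)
    (hsing : Set.range i ⊆ J.singularLocus) (p : N) :
    ∃ ψ ∈ IsManifold.maximalAtlas (𝓡 (2 * n + 1)) ∞ M, ∃ y₀ ∈ ψ.target,
      ∃ (u : EuclideanSpace ℝ (Fin (2 * n + 1)) →L[ℝ] ℝ) (v : EuclideanSpace ℝ (Fin (2 * n + 1)))
        (C : ℝ), u v = 1 ∧ ∀ᶠ y in 𝓝 y₀, |J.topCoeff ψ (ψ.symm y)| ≤ C * |u (y - y₀)| := by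
  have h := hi.isImmersionAt p
  set ψ := h.codChart with hψdef
  have hψ : ψ ∈ IsManifold.maximalAtlas (𝓡 (2 * n + 1)) ∞ M := h.codChart_mem_maximalAtlas
  have hpψ : i p ∈ ψ.source := h.mem_codChart_source
  have hpd : p ∈ h.domChart.source := h.mem_domChart_source
  have hy₀ := ψ.map_source hpψ
  have hwritten : ∀ w ∈ h.domChart.target, h.equiv (w, 0) ∈ ψ.target ∧
      ψ.symm (h.equiv (w, 0)) ∈ Set.range i := by
    intro w hw
    have h1 : ψ (i (h.domChart.symm w)) = h.equiv (w, 0) := by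
      have := h.writtenInCharts
        (show w ∈ (h.domChart.extend (𝓡 (2 * n))).target by simpa using hw)
      simpa using this
    have h2 : i (h.domChart.symm w) ∈ ψ.source :=
      h.source_subset_preimage_source (h.domChart.map_target hw)
    rw [← h1]
    exact ⟨ψ.map_source h2, ⟨_, (ψ.left_inv h2).symm⟩⟩
  have hequiv : h.equiv (h.domChart p, 0) = ψ (i p) := by
    have := h.writtenInCharts (show h.domChart p ∈ (h.domChart.extend (𝓡 (2 * n))).target by
      simpa using h.domChart.map_source hpd)
    simpa [h.domChart.left_inv hpd] using this.symm
  have hfinp : FiniteDimensional ℝ (EuclideanSpace ℝ (Fin (2 * n)) × h.complement) :=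
    h.equiv.symm.toLinearEquiv.finiteDimensional
  have hfin : FiniteDimensional ℝ h.complement :=
    Module.Finite.of_surjective (LinearMap.snd ℝ (EuclideanSpace ℝ (Fin (2 * n))) h.complement)
      LinearMap.snd_surjective
  -- Codimension one: the normal direction of the slice chart is a line, whose coordinate is `u`.
  have hrank : Module.finrank ℝ h.complement = Module.finrank ℝ ℝ := by
    have := h.equiv.toLinearEquiv.finrank_eq
    rw [Module.finrank_prod, finrank_euclideanSpace_fin, finrank_euclideanSpace_fin] at this
    rw [Module.finrank_self]
    omega
  set g : h.complement ≃L[ℝ] ℝ := ContinuousLinearEquiv.ofFinrankEq hrank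
  set u : EuclideanSpace ℝ (Fin (2 * n + 1)) →L[ℝ] ℝ := (g : h.complement →L[ℝ] ℝ) ∘L
    ContinuousLinearMap.snd ℝ (EuclideanSpace ℝ (Fin (2 * n))) h.complement ∘L
    (h.equiv.symm : EuclideanSpace ℝ (Fin (2 * n + 1)) →L[ℝ] _) with hu
  set v : EuclideanSpace ℝ (Fin (2 * n + 1)) := h.equiv (0, g.symm 1) with hv
  have hu₀ : u (ψ (i p)) = 0 := by simp [hu, ← hequiv]
  have huv : u v = 1 := by simp [hu, hv]
  -- Subtracting `u y • v` projects onto the slice `u = 0`, which near `ψ (i p)` consists of points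
  -- of the image of `i`.
  have hproj : ∀ y, y - u y • v = h.equiv ((h.equiv.symm y).1, 0) := by
    intro y
    apply h.equiv.symm.injective
    have : u y • g.symm 1 = (h.equiv.symm y).2 := by
      rw [← map_smul, smul_eq_mul, mul_one]
      simp [hu]
    rw [map_sub, map_smul, hv, h.equiv.symm_apply_apply, h.equiv.symm_apply_apply]
    ext1 <;> simp [this]
  have hzero : ∀ᶠ y in 𝓝 (ψ (i p)), J.topCoeff ψ (ψ.symm (y - u y • v)) = 0 := by
    have hc : ContinuousAt (fun y => (h.equiv.symm y).1) (ψ (i p)) := by fun_prop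
    have h1 : (h.equiv.symm (ψ (i p))).1 = h.domChart p := by simp [← hequiv]
    filter_upwards [hc.eventually_mem
      (h.domChart.open_target.mem_nhds (h1 ▸ h.domChart.map_source hpd))] with y hy
    rw [hproj, topCoeff, hsing (hwritten _ hy).2, map_zero, map_zero]
  have hsm : ContDiffAt ℝ 1 (fun y => J.topCoeff ψ (ψ.symm y)) (ψ (i p)) := by
    have h1 : ContMDiffAt (𝓡 (2 * n + 1)) 𝓘(ℝ, ℝ) ∞ (J.topCoeff ψ) (ψ.symm (ψ (i p))) := by
      rw [ψ.left_inv hpψ]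
      exact J.contMDiffAt_topCoeff hψ hpψ
    have h2 := h1.comp (ψ (i p)) (contMDiffAt_symm_of_mem_maximalAtlas hψ hy₀)
    exact (contMDiffAt_iff_contDiffAt.1 h2).of_le (by simp)
  -- Comparing `y` with its projection, at distance `|u y| * ‖v‖`, where the coefficient vanishes,
  -- gives the constant `L * ‖v‖`.
  obtain ⟨L, t, ht, hL⟩ := hsm.exists_lipschitzOnWith
  refine ⟨ψ, hψ, ψ (i p), hy₀, u, v, L * ‖v‖, huv, ?_⟩
  have hc : ContinuousAt (fun y => y - u y • v) (ψ (i p)) := by fun_prop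
  have hct := hc.eventually_mem (s := t) (by simpa [hu₀] using ht)
  filter_upwards [hzero, hct, ht] with y hy0 hyt' hyt
  have h1 := hL.dist_le_mul y hyt _ hyt'
  rw [hy0, dist_zero_right, Real.norm_eq_abs, dist_eq_norm, sub_sub_cancel, norm_smul,
    Real.norm_eq_abs] at h1
  rw [map_sub, hu₀, sub_zero]
  linarith

end JacobiGeometry

/-! ### The main theorem -/

open Filter Topology in
theorem mainTheorem3 (n : ℕ)
    -- a Jacobi manifold of dimension `2n+1`, contact on a dense open set
    {M : Type*} [TopologicalSpace M] [T2Space M]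
    [ChartedSpace (EuclideanSpace ℝ (Fin (2 * n + 1))) M] [IsManifold (𝓡 (2 * n + 1)) ∞ M]
    (J : JacobiGeometry.JacobiStructure (2 * n + 1) M) (hJ : J.IsContactOnDenseOpen)
    -- a nonempty (immersed or embedded) submanifold of codimension one in the singular locus
    {N : Type*} [TopologicalSpace N] [Nonempty N]
    [ChartedSpace (EuclideanSpace ℝ (Fin (2 * n))) N] [IsManifold (𝓡 (2 * n)) ∞ N]
    (i : N → M) (hi : Manifold.IsImmersion (𝓡 (2 * n)) (𝓡 (2 * n + 1)) ∞ i)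
    (hinj : Function.Injective i) (hsing : Set.range i ⊆ J.singularLocus)
    -- a contact resolution
    {S : Type*} [TopologicalSpace S] [T2Space S]
    [ChartedSpace (EuclideanSpace ℝ (Fin (2 * n + 1))) S] [IsManifold (𝓡 (2 * n + 1)) ∞ S]
    (K : JacobiGeometry.JacobiStructure (2 * n + 1) S) (φ : S → M)
    (hres : JacobiGeometry.IsContactResolution K J φ) :
    ¬ IsProperMap φ := by
  intro hprop
  obtain ⟨ψ, hψ, y₀, hy₀, u, v, C, huv, hC⟩ :=
    J.exists_abs_topCoeff_le hi hsing (Classical.arbitrary N)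
  obtain ⟨r, hr, hball⟩ := Metric.nhds_basis_closedBall.mem_iff.1
    (hC.and (ψ.open_target.mem_nhds hy₀))
  have hcompact : IsCompact (φ ⁻¹' (ψ.symm '' Metric.closedBall y₀ r)) :=
    hprop.isCompact_preimage ((isCompact_closedBall y₀ r).image_of_continuousOn
      (ψ.continuousOn_symm.mono fun y hy => (hball hy).2))
  let χ : S → OpenPartialHomeomorph S (EuclideanSpace ℝ (Fin (2 * n + 1))) := fun s => chartAt _ s
  have hχ : ∀ s, χ s ∈ IsManifold.maximalAtlas (𝓡 (2 * n + 1)) ∞ S :=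
    fun s => IsManifold.chart_mem_maximalAtlas s
  have hχs : ∀ s, s ∈ (χ s).source := fun s => mem_chart_source _ s
  -- The contact condition supplies the lower bound `c`; landing in a unit ball keeps the volume in
  -- the chart finite.
  have hnhds : ∀ a : φ ⁻¹' ψ.source, ∃ W : Set S, IsOpen W ∧ a.1 ∈ W ∧ ∃ c : ℝ, 0 < c ∧
      ∀ s ∈ W, c ≤ |K.topCoeff (χ a.1) s| ∧ s ∈ (χ a.1).source ∧ φ s ∈ ψ.source ∧
        χ a.1 s ∈ Metric.ball (χ a.1 a.1) 1 := by
    intro a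
    have hne : 0 < |K.topCoeff (χ a.1) a.1| :=
      abs_pos.2 (K.topCoeff_ne_zero (hχ _) (hχs _) (hres.contact _))
    have h1 : ∀ᶠ s in 𝓝 a.1, |K.topCoeff (χ a.1) a.1| / 2 < |K.topCoeff (χ a.1) s| :=
      (K.contMDiffAt_topCoeff (hχ a.1) (hχs _)).continuousAt.abs.eventually
        (lt_mem_nhds (half_lt_self hne))
    have h2 : ∀ᶠ s in 𝓝 a.1, s ∈ (χ a.1).source := (χ a.1).open_source.mem_nhds (hχs a.1)
    have h3 := hprop.continuous.continuousAt.eventually_mem (ψ.open_source.mem_nhds a.2)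
    have h4 := ((χ a.1).continuousAt (hχs a.1)).eventually_mem (Metric.ball_mem_nhds _ one_pos)
    obtain ⟨W, hW, hWo, haW⟩ := eventually_nhds_iff.1 (h1.and (h2.and (h3.and h4)))
    exact ⟨W, hWo, haW, _, half_pos hne, fun s hs => ⟨(hW s hs).1.le, (hW s hs).2⟩⟩
  choose W hWo haW c hc hW using hnhds
  obtain ⟨t, ht⟩ := hcompact.elim_finite_subcover W hWo (by
    rintro s ⟨y, hy, hys⟩
    have : φ s ∈ ψ.source := hys ▸ ψ.map_target (hball hy).2
    exact Set.mem_iUnion.2 ⟨⟨s, this⟩, haW _⟩)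
  have hkey : ∀ a : φ ⁻¹' ψ.source, ∀ x ∈ (χ a.1).target ∩ (χ a.1).symm ⁻¹' W a,
      DifferentiableAt ℝ (ψ ∘ φ ∘ (χ a.1).symm) x ∧
        (fderiv ℝ (ψ ∘ φ ∘ (χ a.1).symm) x).det * K.topCoeff (χ a.1) ((χ a.1).symm x) =
          J.topCoeff ψ (φ ((χ a.1).symm x)) := by
    rintro a x ⟨hx, hxW⟩
    have h := hres.morphism.det_fderiv_mul_topCoeff (hχ a.1) hψ ((χ a.1).map_target hx)
      (hW a _ hxW).2.2.1
    rwa [(χ a.1).right_inv hx] at h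
  refine not_ball_subset_biUnion_image_of_det_le MeasureTheory.volume t
    (fun a => (χ a.1).target ∩ (χ a.1).symm ⁻¹' W a)
    (fun a => (χ a.1).isOpen_inter_preimage_symm (hWo a)) (fun a => ?_)
    (fun a => ψ ∘ φ ∘ (χ a.1).symm) (fun a => fderiv ℝ (ψ ∘ φ ∘ (χ a.1).symm))
    -- On the piece at `a` the Jacobian is at most `|C| / c a` times `|u|`; the sum is a single
    -- constant valid for all pieces.
    (fun a x hx => (hkey a x hx).1.hasFDerivAt) u v huv y₀ hr (∑ a ∈ t, |C| / c a) ?_ ?_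
  · refine ((MeasureTheory.measure_mono ?_).trans_lt
      (MeasureTheory.measure_ball_lt_top (x := χ a.1 a.1) (r := 1))).ne
    rintro x ⟨hx, hxW⟩
    simpa [(χ a.1).right_inv hx] using (hW a _ hxW).2.2.2
  · intro a ha x hx hxb
    have hdet := congrArg abs (hkey a x hx).2
    have hle := (hball (Metric.ball_subset_closedBall hxb)).1
    have hWx := hW a _ hx.2
    simp only [Function.comp_apply, ψ.left_inv hWx.2.2.1] at hle
    rw [← hdet, abs_mul] at hle
    have hsum : |C| / c a ≤ ∑ a ∈ t, |C| / c a :=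
      Finset.single_le_sum (f := fun a => |C| / c a)
        (fun b _ => div_nonneg (abs_nonneg _) (hc b).le) ha
    set D := |(fderiv ℝ (ψ ∘ φ ∘ (χ a.1).symm) x).det| with hD
    set U := |u (ψ (φ ((χ a.1).symm x)) - y₀)| with hU
    have h1 : D * c a ≤ |C| * U :=
      calc D * c a ≤ D * |K.topCoeff (χ a.1) ((χ a.1).symm x)| :=
            mul_le_mul_of_nonneg_left hWx.1 (abs_nonneg _)
        _ ≤ C * U := hle
        _ ≤ |C| * U := mul_le_mul_of_nonneg_right (le_abs_self C) (abs_nonneg _)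
    calc D ≤ |C| * U / c a := (le_div_iff₀ (hc a)).2 h1
      _ = |C| / c a * U := by ring
      _ ≤ _ := mul_le_mul_of_nonneg_right hsum (abs_nonneg _)
  · intro y hy
    have hy' := Metric.ball_subset_closedBall hy
    obtain ⟨s, hs⟩ := hres.surjective (ψ.symm y)
    obtain ⟨a, ha, hsa⟩ := Set.mem_iUnion₂.1 (ht (show s ∈ φ ⁻¹' _ from ⟨y, hy', hs.symm⟩))
    have hsrc := (hW a s hsa).2.1
    refine Set.mem_iUnion₂.2 ⟨a, ha, χ a.1 s, ⟨(χ a.1).map_source hsrc, ?_⟩, ?_⟩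
    · rwa [Set.mem_preimage, (χ a.1).left_inv hsrc]
    · simp only [Function.comp_apply]
      rw [(χ a.1).left_inv hsrc, hs, ψ.right_inv (hball hy').2]
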